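/- Let $X$ be a smooth $7$-manifold with a smooth Riemannian metric $g$, Levi-Civita connection $\nabla$, and a smooth $3$-form $\varphi$ with $\nabla\varphi=0$ such that each $T_xX$ has a $g$-orthonormal basis with dual basis $\varepsilon^1,\dots,\varepsilon^7$ in which $$\varphi=\varepsilon^{123}+\varepsilon^1\wedge(\varepsilon^{45}-\varepsilon^{67})+\varepsilon^2\wedge(\varepsilon^{46}-\varepsilon^{75})+\varepsilon^3\wedge(\varepsilon^{47}-\varepsilon^{56})$$ (so $X$ is a manifold with holonomy contained in $G_2$). Let $\times$ be the cross product on tangent spaces given by $g(u,y\times z)=\varphi(u,y,z)$. Let $\pi:Z_7\to X$ be the unit sphere bundle of $TX$, with $T_\eta Z_7=V_\eta\oplus H_\eta$ the splitting into the vertical space $\ker\pi_*$ and the horizontal space of $\nabla$. For $\eta\in Z_7$ put $E_\eta=\langle\eta\rangle^\perp\subseteq T_{\pi(\eta)}X$ and $\mathcal E_\eta=\pi_*^{-1}(E_\eta)\subseteq T_\eta Z_7$, so that $\mathcal E_\eta=E^V_\eta\oplus E^H_\eta$ with $E^V_\eta=V_\eta$ and $E^H_\eta=H_\eta\cap\pi_*^{-1}(E_\eta)$.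 Let $\mathcal J$ be the complex structure $v\mapsto\eta\times v$ on $E_\eta$, and also the complex structure on $E^H_\eta$ that corresponds to it under the isomorphism $\pi_*:E^H_\eta\to E_\eta$. Let $(\Sigma,h)$ be an oriented Riemannian surface with the complex structure $J_h$ given by rotation through a right angle, let $f:\Sigma\to X$ be a smooth immersion, and let $\tilde f_7$ be the $7$-dimensional Gauss lift, which sends $p\in\Sigma$ to $y\times z\in T_{f(p)}X$, where $(y,z)$ is any oriented orthonormal basis of $f_*(T_p\Sigma)$. Then $\tilde f_7$ is a smooth map from $\Sigma$ to $Z_7$ whose derivative takes values in $\mathcal E$, and the horizontal component $$T_p\Sigma\to E^H_{\tilde f_7(p)},\qquad v\mapsto(\tilde f_{7*}v)^H,$$ is complex linear with respect to $J_h$ and $\mathcal J$ at every $p\in\Sigma$ if and only if $f$ is conformal, that is, $f^*g=\rho\,h$ for some function $\rho:\Sigma\to(0,\infty)$. -/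

import Mathlib

open Bundle
open scoped Manifold ContDiff RealInnerProductSpace

set_option linter.unusedSectionVars false

namespace G2Geom

noncomputable section

open FiberBundle Module VectorField

section LeviCivita

variable {E : Type*} [NormedAddCommGroup E] [NormedSpace ℝ E] [FiniteDimensional ℝ E]
  {H : Type*} [TopologicalSpace H] {I : ModelWithCorners ℝ E H}
  {M : Type*} [TopologicalSpace M] [ChartedSpace H M] [IsManifold I ∞ M]
  [RiemannianBundle (fun x : M => TangentSpace I x)]

/-- The right-hand side of the Koszul formula for `2 ⟨∇_U V, W⟩`. -/
def koszul (V U W : ∀ x : M, TangentSpace I x) (x : M) : ℝ :=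
  mvfderiv I (fun y => ⟪V y, W y⟫) x (U x)
    + mvfderiv I (fun y => ⟪U y, W y⟫) x (V x)
    - mvfderiv I (fun y => ⟪U y, V y⟫) x (W x)
    + ⟪mlieBracket I U V x, W x⟫
    - ⟪mlieBracket I V W x, U x⟫
    - ⟪mlieBracket I U W x, V x⟫

variable [IsContMDiffRiemannianBundle I ∞ E (fun x : M => TangentSpace I x)]

lemma inner_mdiff {U V : ∀ x : M, TangentSpace I x} {x : M}
    (hU : MDiffAt (T% U) x) (hV : MDiffAt (T% V) x) :
    MDifferentiableAt I 𝓘(ℝ, ℝ) (fun y => ⟪U y, V y⟫) x :=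
  MDifferentiableAt.inner_bundle (F := E) (E := fun x : M => TangentSpace I x) hU hV

lemma koszul_tensorial_left {V W : ∀ x : M, TangentSpace I x} {x : M}
    (hV : MDiffAt (T% V) x) (hW : MDiffAt (T% W) x) :
    TensorialAt I E (fun U => koszul V U W x) x where
  smul {f U} hf hU := by
    simp [koszul, inner_smul_left, inner_add_left, inner_smul_right,
      mvfderiv_fun_mul hf (inner_mdiff hU hW), mvfderiv_fun_mul hf (inner_mdiff hU hV),
      mlieBracket_smul_left hf hU]
    simp only [real_inner_comm]
    ring
  add {U U'} hU hU' := by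
    simp [koszul, inner_add_left, inner_add_right,
      mvfderiv_fun_add (inner_mdiff hU hW) (inner_mdiff hU' hW),
      mvfderiv_fun_add (inner_mdiff hU hV) (inner_mdiff hU' hV), mlieBracket_add_left hU hU']
    ring

lemma koszul_tensorial_right {V U : ∀ x : M, TangentSpace I x} {x : M}
    (hV : MDiffAt (T% V) x) (hU : MDiffAt (T% U) x) :
    TensorialAt I E (fun W => koszul V U W x) x where
  smul {f W} hf hW := by
    simp [koszul, inner_smul_left, inner_add_left, inner_smul_right,
      mvfderiv_fun_mul hf (inner_mdiff hV hW), mvfderiv_fun_mul hf (inner_mdiff hU hW),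
      mlieBracket_smul_right hf hW]
    simp only [real_inner_comm]
    ring
  add {W W'} hW hW' := by
    simp [koszul, inner_add_left, inner_add_right,
      mvfderiv_fun_add (inner_mdiff hV hW) (inner_mdiff hV hW'),
      mvfderiv_fun_add (inner_mdiff hU hW) (inner_mdiff hU hW'), mlieBracket_add_right hW hW']
    ring

instance finiteDimensional_tangentSpace (x : M) : FiniteDimensional ℝ (TangentSpace I x) :=
  VectorBundle.finiteDimensional ℝ E _ x
instance completeSpace_tangentSpace (x : M) : CompleteSpace (TangentSpace I x) := FiniteDimensional.complete ℝ _

open Classical in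
/-- `leviCivitaFun V x u = (∇_u V)(x)`, the vector determined by the Koszul formula (and zero when
`V` is not differentiable at `x`). -/
def leviCivitaFun (V : ∀ x : M, TangentSpace I x) (x : M) :
    TangentSpace I x →L[ℝ] TangentSpace I x :=
  if hV : MDifferentiableAt I I.tangent (fun y => (⟨y, V y⟩ : TangentBundle I M)) x then
    let K := TensorialAt.mkHom₂ (fun U W => koszul V U W x) x
      (fun _ hW => koszul_tensorial_left hV hW) (fun _ hU => koszul_tensorial_right hV hU)
    LinearMap.toContinuousLinearMap
      { toFun := fun u => (1 / 2 : ℝ) • (InnerProductSpace.toDual ℝ (TangentSpace I x)).symm (K u)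
        map_add' := fun u u' => by simp
        map_smul' := fun c u => by simp [smul_comm c] }
  else 0

lemma inner_leviCivitaFun {V U W : ∀ x : M, TangentSpace I x} {x : M}
    (hV : MDiffAt (T% V) x) (hU : MDiffAt (T% U) x) (hW : MDiffAt (T% W) x) :
    ⟪leviCivitaFun V x (U x), W x⟫ = 1 / 2 * koszul V U W x := by
  have hV' : MDifferentiableAt I I.tangent (fun y => (⟨y, V y⟩ : TangentBundle I M)) x := hV
  have := TensorialAt.mkHom₂_apply (Φ := fun U W => koszul V U W x)
    (fun _ hW => koszul_tensorial_left hV hW) (fun _ hU => koszul_tensorial_right hV hU) hU hW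
  rw [leviCivitaFun, dif_pos hV', ← this]
  simp [inner_smul_left]

lemma ext_inner_sections {x : M} {a b : TangentSpace I x}
    (h : ∀ W : ∀ x : M, TangentSpace I x, MDiffAt (T% W) x → ⟪a, W x⟫ = ⟪b, W x⟫) : a = b := by
  refine ext_inner_right ℝ fun w => ?_
  simpa using h (extend E w) (mdifferentiableAt_extend ..)

/-- The Levi-Civita connection of a Riemannian manifold. -/
def leviCivita : CovariantDerivative I E (fun x : M => TangentSpace I x) where
  toFun := leviCivitaFun
  isCovariantDerivativeOnUniv :=
    { add := by
        intro V V' x hV hV' _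
        ext u
        obtain ⟨U, hU, rfl⟩ : ∃ U : ∀ x : M, TangentSpace I x, MDiffAt (T% U) x ∧ U x = u :=
          ⟨extend E u, mdifferentiableAt_extend .., by simp⟩
        refine ext_inner_sections fun W hW => ?_
        rw [add_apply, inner_add_left, inner_leviCivitaFun hV hU hW,
          inner_leviCivitaFun hV' hU hW, inner_leviCivitaFun (mdifferentiableAt_add_section hV hV') hU hW]
        simp [koszul, inner_add_left, inner_add_right,
          mvfderiv_fun_add (inner_mdiff hV hW) (inner_mdiff hV' hW),
          mvfderiv_fun_add (inner_mdiff hU hV) (inner_mdiff hU hV'),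
          mlieBracket_add_left hV hV', mlieBracket_add_right hV hV']
        ring
      leibniz := by
        intro V f x hV hf _
        ext u
        obtain ⟨U, hU, rfl⟩ : ∃ U : ∀ x : M, TangentSpace I x, MDiffAt (T% U) x ∧ U x = u :=
          ⟨extend E u, mdifferentiableAt_extend .., by simp⟩
        refine ext_inner_sections fun W hW => ?_
        rw [add_apply, inner_add_left, smul_apply,
          inner_smul_left, inner_leviCivitaFun hV hU hW,
          inner_leviCivitaFun (hf.smul_section hV) hU hW]
        simp [koszul, inner_smul_left, inner_add_left, inner_smul_right,
          mvfderiv_fun_mul hf (inner_mdiff hV hW), mvfderiv_fun_mul hf (inner_mdiff hU hV),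
          mlieBracket_smul_left hf hV, mlieBracket_smul_right hf hV]
        simp only [real_inner_comm]
        ring }

lemma leviCivita_isMetricCompatible :
    CovariantDerivative.IsMetricCompatible (I := I) (F := E) (V := fun x : M => TangentSpace I x)
      leviCivita := by
  rw [CovariantDerivative.isMetricCompatible_iff]
  intro x U V W hU hV hW
  have h1 := inner_leviCivitaFun hV hU hW
  have h2 := inner_leviCivitaFun hW hU hV
  have h3 := congrFun (mlieBracket_swap (I := I) (V := V) (W := W)) x
  rw [real_inner_comm] at h2
  change _ = ⟪leviCivitaFun V x (U x), W x⟫ + ⟪V x, leviCivitaFun W x (U x)⟫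
  rw [h1, h2]
  simp only [koszul, h3]
  simp [real_inner_comm]
  ring

lemma leviCivita_torsion :
    (leviCivita : CovariantDerivative I E (fun x : M => TangentSpace I x)).torsion = 0 := by
  rw [CovariantDerivative.torsion_eq_zero_iff]
  intro U V x hU hV
  refine ext_inner_sections fun W hW => ?_
  change ⟪leviCivitaFun V x (U x) - leviCivitaFun U x (V x), W x⟫ = _
  have h3 := congrFun (mlieBracket_swap (I := I) (V := V) (W := U)) x
  rw [inner_sub_left, inner_leviCivitaFun hV hU hW, inner_leviCivitaFun hU hV hW]
  simp only [koszul, h3]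
  simp [real_inner_comm]
  ring

end LeviCivita

section G2

/-- The elementary 3-form `ε^i ∧ ε^j ∧ ε^k` on `ℝ⁷`. -/
def elemForm (i j k : Fin 7) (u v w : EuclideanSpace ℝ (Fin 7)) : ℝ :=
  Matrix.det !![u i, v i, w i; u j, v j, w j; u k, v k, w k]

/-- The model 3-form
`φ₀ = ε¹²³ + ε¹ ∧ (ε⁴⁵ - ε⁶⁷) + ε² ∧ (ε⁴⁶ - ε⁷⁵) + ε³ ∧ (ε⁴⁷ - ε⁵⁶)`
(the basis vectors are numbered from `0` to `6` here). -/
def phi0 (u v w : EuclideanSpace ℝ (Fin 7)) : ℝ :=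
  elemForm 0 1 2 u v w
    + (elemForm 0 3 4 u v w - elemForm 0 5 6 u v w)
    + (elemForm 1 3 5 u v w - elemForm 1 6 4 u v w)
    + (elemForm 2 3 6 u v w - elemForm 2 4 5 u v w)

variable {X : Type*} [TopologicalSpace X] [ChartedSpace (EuclideanSpace ℝ (Fin 7)) X] [IsManifold (𝓡 7) ∞ X]
  [RiemannianBundle (fun x : X => TangentSpace (𝓡 7) x)]
  [IsContMDiffRiemannianBundle (𝓡 7) ∞ (EuclideanSpace ℝ (Fin 7)) (fun x : X => TangentSpace (𝓡 7) x)]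

/-- Smoothness of a vector field at a point. -/
def SmoothAt (U : ∀ x : X, TangentSpace (𝓡 7) x) (x : X) : Prop :=
  ContMDiffAt (𝓡 7) (𝓡 7).tangent ∞ (fun y => (⟨y, U y⟩ : TangentBundle (𝓡 7) X)) x

/-- `φ` makes the Riemannian manifold `X` into a manifold with holonomy contained in `G₂`: it is a
smooth 3-form, at each point it is the model form in some orthonormal basis, and it is parallel for
the Levi-Civita connection. -/
structure IsG2Manifold (φ : ∀ x : X, TangentSpace (𝓡 7) x [⋀^Fin 3]→L[ℝ] ℝ) : Prop where
  model : ∀ x : X, ∃ e : EuclideanSpace ℝ (Fin 7) ≃ₗᵢ[ℝ] TangentSpace (𝓡 7) x,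
    ∀ u v w, φ x ![e u, e v, e w] = phi0 u v w
  smooth : ∀ (U V W : ∀ x : X, TangentSpace (𝓡 7) x) (x : X),
    SmoothAt U x → SmoothAt V x → SmoothAt W x →
      ContMDiffAt (𝓡 7) 𝓘(ℝ, ℝ) ∞ (fun y => φ y ![U y, V y, W y]) x
  parallel : ∀ (U V W : ∀ x : X, TangentSpace (𝓡 7) x) (x : X) (v : TangentSpace (𝓡 7) x),
    SmoothAt U x → SmoothAt V x → SmoothAt W x →
      mvfderiv (𝓡 7) (fun y => φ y ![U y, V y, W y]) x v =
        φ x ![leviCivita U x v, V x, W x] + φ x ![U x, leviCivita V x v, W x]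
          + φ x ![U x, V x, leviCivita W x v]

/-- The cross product `y × z` on a tangent space, defined by `⟨u, y × z⟩ = φ(u, y, z)`. -/
def cross (φ : ∀ x : X, TangentSpace (𝓡 7) x [⋀^Fin 3]→L[ℝ] ℝ) {x : X}
    (y z : TangentSpace (𝓡 7) x) : TangentSpace (𝓡 7) x :=
  (InnerProductSpace.toDual ℝ (TangentSpace (𝓡 7) x)).symm <| LinearMap.toContinuousLinearMap
    { toFun := fun u => φ x ![u, y, z]
      map_add' := fun u u' => (φ x).toMultilinearMap.cons_add ![y, z] u u'
      map_smul' := fun c u => (φ x).toMultilinearMap.cons_smul ![y, z] c u }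

lemma inner_cross (φ : ∀ x : X, TangentSpace (𝓡 7) x [⋀^Fin 3]→L[ℝ] ℝ) {x : X}
    (u y z : TangentSpace (𝓡 7) x) : ⟪u, cross φ y z⟫ = φ x ![u, y, z] := by
  rw [real_inner_comm]
  simp only [cross, InnerProductSpace.toDual_symm_apply]
  rfl

/-- Left multiplication `v ↦ η × v` by a tangent vector `η`. -/
def crossLeft (φ : ∀ x : X, TangentSpace (𝓡 7) x [⋀^Fin 3]→L[ℝ] ℝ) {x : X}
    (η : TangentSpace (𝓡 7) x) : TangentSpace (𝓡 7) x →ₗ[ℝ] TangentSpace (𝓡 7) x where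
  toFun v := cross φ η v
  map_add' v v' := by
    refine ext_inner_left ℝ fun u => ?_
    have h (a : TangentSpace (𝓡 7) x) : Function.update ![u, η, 0] 2 a = ![u, η, a] := by
      ext1 i; fin_cases i <;> rfl
    rw [inner_add_right, inner_cross, inner_cross, inner_cross, ← h (v + v'), ← h v, ← h v']
    exact (φ x).map_update_add ![u, η, 0] 2 v v'
  map_smul' c v := by
    refine ext_inner_left ℝ fun u => ?_
    have h (a : TangentSpace (𝓡 7) x) : Function.update ![u, η, 0] 2 a = ![u, η, a] := by
      ext1 i; fin_cases i <;> rfl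
    rw [inner_smul_right, inner_cross, inner_cross, ← h (c • v), ← h v]
    exact (φ x).map_update_smul ![u, η, 0] 2 c v

/-- The cross product satisfies `|y × z| = |y ∧ z|`. -/
lemma norm_cross_sq {φ : ∀ x : X, TangentSpace (𝓡 7) x [⋀^Fin 3]→L[ℝ] ℝ}
    (hφ : IsG2Manifold φ) {x : X} (y z : TangentSpace (𝓡 7) x) :
    ‖cross φ y z‖ ^ 2 = ‖y‖ ^ 2 * ‖z‖ ^ 2 - ⟪y, z⟫ ^ 2 := by
  obtain ⟨e, he⟩ := hφ.model x
  obtain ⟨v, rfl⟩ := e.surjective y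
  obtain ⟨w, rfl⟩ := e.surjective z
  have h1 := ((EuclideanSpace.basisFun (Fin 7) ℝ).map e).sum_sq_norm_inner_right
    (cross φ (e v) (e w))
  simp only [OrthonormalBasis.map_apply, inner_cross, he] at h1
  rw [← h1, e.norm_map, e.norm_map, e.inner_map_map, EuclideanSpace.norm_sq_eq,
    EuclideanSpace.norm_sq_eq]
  simp [Fin.sum_univ_succ, phi0, elemForm, Matrix.det_fin_three, PiLp.inner_apply]
  ring

/-! ### The unit tangent bundle, its horizontal distribution and the distribution `𝓔` -/

variable (X) in
/-- The bundle `Z₇` of unit tangent vectors. -/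
def unitTangentBundle : Set (TangentBundle (𝓡 7) X) := {η | ‖η.2‖ = 1}

/-- The derivative `π_*` at `η` of the projection `π : TX → X`. -/
def projDeriv (η : TangentBundle (𝓡 7) X) :
    TangentSpace (𝓡 7).tangent η →L[ℝ] TangentSpace (𝓡 7) η.1 :=
  mfderiv (𝓡 7).tangent (𝓡 7) (fun ζ : TangentBundle (𝓡 7) X => ζ.1) η

/-- The tangent space `T_η Z₇ ⊆ T_η TX` at `η ∈ Z₇`: the kernel of the derivative of the function
`ζ ↦ |ζ|²`, of which `Z₇` is a regular level set. -/
def unitTangent (η : TangentBundle (𝓡 7) X) : Submodule ℝ (TangentSpace (𝓡 7).tangent η) :=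
  LinearMap.ker (mvfderiv (𝓡 7).tangent (fun ζ : TangentBundle (𝓡 7) X => ⟪ζ.2, ζ.2⟫) η).toLinearMap

/-- The subspace `E_η = ⟨η⟩^⊥` of the tangent space of `X`. -/
def perp (η : TangentBundle (𝓡 7) X) : Submodule ℝ (TangentSpace (𝓡 7) η.1) := (ℝ ∙ η.2)ᗮ

/-- The vertical lift: the derivative at `η ∈ T_x X` of the inclusion of the fibre `T_x X` in
`TX`. -/
def verticalLift (η : TangentBundle (𝓡 7) X) :
    TangentSpace (𝓡 7) η.1 →L[ℝ] TangentSpace (𝓡 7).tangent η :=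
  mfderiv 𝓘(ℝ, TangentSpace (𝓡 7) η.1) (𝓡 7).tangent
    (fun u : TangentSpace (𝓡 7) η.1 => (⟨η.1, u⟩ : TangentBundle (𝓡 7) X)) η.2

/-- The derivative `Y_*` at the base point of `η` of the extension `Y` of `η` to a vector field that
Mathlib provides (it is constant in the trivialization at the base point). -/
def extendDeriv (η : TangentBundle (𝓡 7) X) :
    TangentSpace (𝓡 7) η.1 →L[ℝ] TangentSpace (𝓡 7).tangent η :=
  mfderiv (𝓡 7) (𝓡 7).tangent
    (fun y => (⟨y, extend (EuclideanSpace ℝ (Fin 7)) η.2 y⟩ : TangentBundle (𝓡 7) X)) η.1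

/-- The horizontal lift of `v` to `η`: extend `η` to a vector field `Y` near the base point and put
`v^H = Y_* v - (∇_v Y)^V`. -/
def horizontalLift (η : TangentBundle (𝓡 7) X) :
    TangentSpace (𝓡 7) η.1 →L[ℝ] TangentSpace (𝓡 7).tangent η :=
  extendDeriv η - verticalLift η ∘L leviCivita (extend (EuclideanSpace ℝ (Fin 7)) η.2) η.1

lemma projDeriv_verticalLift (η : TangentBundle (𝓡 7) X) (v : TangentSpace (𝓡 7) η.1) :
    projDeriv η (verticalLift η v) = 0 := by
  by_cases hv : MDifferentiableAt 𝓘(ℝ, TangentSpace (𝓡 7) η.1) (𝓡 7).tangent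
    (fun u : TangentSpace (𝓡 7) η.1 => (⟨η.1, u⟩ : TangentBundle (𝓡 7) X)) η.2
  · have h := mfderiv_comp_apply_of_eq (I := 𝓘(ℝ, TangentSpace (𝓡 7) η.1)) (I' := (𝓡 7).tangent)
      (I'' := 𝓡 7) (g := fun ζ : TangentBundle (𝓡 7) X => ζ.1) (y := η)
      (x := η.2) (mdifferentiableAt_proj _) hv rfl v
    refine Eq.trans h.symm ?_
    have h0 := mfderiv_const (I := 𝓘(ℝ, TangentSpace (𝓡 7) η.1)) (I' := 𝓡 7) (c := η.1) (x := η.2)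
    exact congrArg (fun L => L v) h0
  · rw [verticalLift, mfderiv_zero_of_not_mdifferentiableAt hv]
    exact map_zero (projDeriv η)

lemma mdiff_extend (η : TangentBundle (𝓡 7) X) :
    MDifferentiableAt (𝓡 7) (𝓡 7).tangent
      (fun y => (⟨y, extend (EuclideanSpace ℝ (Fin 7)) η.2 y⟩ : TangentBundle (𝓡 7) X)) η.1 :=
  mdifferentiableAt_extend ..

lemma projDeriv_extendDeriv (η : TangentBundle (𝓡 7) X) (v : TangentSpace (𝓡 7) η.1) :
    projDeriv η (extendDeriv η v) = v := by
  have h := mfderiv_comp_apply_of_eq (I := 𝓡 7) (I' := (𝓡 7).tangent)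
      (I'' := 𝓡 7) (g := fun ζ : TangentBundle (𝓡 7) X => ζ.1) (y := η)
      (x := η.1) (mdifferentiableAt_proj _) (mdiff_extend η) (by simp) v
  refine Eq.trans h.symm ?_
  exact congrArg (fun L => L v) (mfderiv_id (I := 𝓡 7) (x := η.1))

lemma projDeriv_horizontalLift (η : TangentBundle (𝓡 7) X) (v : TangentSpace (𝓡 7) η.1) :
    projDeriv η (horizontalLift η v) = v := by
  rw [horizontalLift, sub_apply, map_sub, projDeriv_extendDeriv]
  exact (congrArg (v - ·) (projDeriv_verticalLift η _)).trans (sub_zero v)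

instance isContMDiffRiemannianBundle_one : IsContMDiffRiemannianBundle (𝓡 7) 1 (EuclideanSpace ℝ (Fin 7))
    (fun x : X => TangentSpace (𝓡 7) x) :=
  .of_le (n := ∞) (by simp)

lemma mdiff_inner_self (η : TangentBundle (𝓡 7) X) :
    MDifferentiableAt (𝓡 7).tangent 𝓘(ℝ, ℝ) (fun ζ : TangentBundle (𝓡 7) X => ⟪ζ.2, ζ.2⟫) η :=
  MDifferentiableAt.inner_bundle (IB := 𝓡 7) (F := EuclideanSpace ℝ (Fin 7))
    (E := fun x : X => TangentSpace (𝓡 7) x) (b := fun ζ : TangentBundle (𝓡 7) X => ζ.1)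
    (v := fun ζ => ζ.2) (w := fun ζ => ζ.2) mdifferentiableAt_id mdifferentiableAt_id

lemma mdiff_fibre (η : TangentBundle (𝓡 7) X) :
    MDifferentiableAt 𝓘(ℝ, TangentSpace (𝓡 7) η.1) (𝓡 7).tangent
    (fun u : TangentSpace (𝓡 7) η.1 => (⟨η.1, u⟩ : TangentBundle (𝓡 7) X)) η.2 := by
  rw [mdifferentiableAt_totalSpace]
  refine ⟨mdifferentiableAt_const, ?_⟩
  have := ((trivializationAt (EuclideanSpace ℝ (Fin 7)) (TangentSpace (𝓡 7) : X → Type _)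
    η.1).continuousLinearMapAt ℝ η.1).differentiableAt (x := η.2)
  refine this.mdifferentiableAt.congr_of_eventuallyEq (.of_forall fun u => ?_)
  exact (congrFun (Trivialization.coe_linearMapAt_of_mem _
    (FiberBundle.mem_baseSet_trivializationAt' η.1)) u).symm

lemma inner_self_verticalLift (η : TangentBundle (𝓡 7) X) (v : TangentSpace (𝓡 7) η.1) :
    mvfderiv (𝓡 7).tangent (fun ζ : TangentBundle (𝓡 7) X => ⟪ζ.2, ζ.2⟫) η (verticalLift η v)
      = 2 * ⟪v, η.2⟫ := by
  have h := mvfderiv_comp_apply_of_eq (I' := 𝓘(ℝ, TangentSpace (𝓡 7) η.1)) (I := (𝓡 7).tangent)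
    (g := fun ζ : TangentBundle (𝓡 7) X => ⟪ζ.2, ζ.2⟫) (y := η) (x := η.2)
    (mdiff_inner_self η) (mdiff_fibre η) rfl v
  refine Eq.trans h.symm ?_
  have h1 : HasFDerivAt (fun u : TangentSpace (𝓡 7) η.1 => ⟪u, u⟫)
      (2 • innerSL ℝ η.2) η.2 := (hasStrictFDerivAt_norm_sq η.2).hasFDerivAt.congr_of_eventuallyEq
        (.of_forall fun u => real_inner_self_eq_norm_sq u)
  have h2 := h1.hasMFDerivAt.mfderiv
  refine (congrArg (fun L => L v) h2).trans ?_
  change (2 • innerSL ℝ η.2 : TangentSpace (𝓡 7) η.1 →L[ℝ] ℝ) v = _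
  rw [real_inner_comm]
  simp

lemma inner_self_extendDeriv (η : TangentBundle (𝓡 7) X) (v : TangentSpace (𝓡 7) η.1) :
    mvfderiv (𝓡 7).tangent (fun ζ : TangentBundle (𝓡 7) X => ⟪ζ.2, ζ.2⟫) η (extendDeriv η v)
      = 2 * ⟪leviCivita (I := 𝓡 7) (extend (EuclideanSpace ℝ (Fin 7)) η.2) η.1 v, η.2⟫ := by
  have h := mvfderiv_comp_apply_of_eq (I' := 𝓡 7) (I := (𝓡 7).tangent)
    (g := fun ζ : TangentBundle (𝓡 7) X => ⟪ζ.2, ζ.2⟫) (y := η) (x := η.1)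
    (mdiff_inner_self η) (mdiff_extend η) (by simp) v
  refine Eq.trans h.symm ?_
  have h2 := CovariantDerivative.IsMetricCompatible.mvfderiv_inner_eq
    (leviCivita_isMetricCompatible (I := 𝓡 7) (M := X)) (fun y => extend (EuclideanSpace ℝ (Fin 7)) v y) (mdiff_extend η) (mdiff_extend η)
  simp only [extend_apply_self] at h2
  refine Eq.trans h2 ?_
  rw [real_inner_comm]; ring

/-- Horizontal lifts are tangent to `Z₇`. -/
lemma horizontalLift_mem (η : TangentBundle (𝓡 7) X) (v : TangentSpace (𝓡 7) η.1) :
    horizontalLift η v ∈ unitTangent η := by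
  change mvfderiv (𝓡 7).tangent (fun ζ : TangentBundle (𝓡 7) X => ⟪ζ.2, ζ.2⟫) η
    (horizontalLift η v) = 0
  rw [horizontalLift, sub_apply, map_sub, inner_self_extendDeriv]
  exact sub_eq_zero.2 (inner_self_verticalLift η _).symm

/-- `V_η`: the vertical tangent vectors of `Z₇` at `η`; this is also the vertical summand `E^V_η`
of `𝓔_η`. -/
def verticalSpace (η : TangentBundle (𝓡 7) X) : Submodule ℝ (TangentSpace (𝓡 7).tangent η) :=
  unitTangent η ⊓ LinearMap.ker (projDeriv η).toLinearMap

/-- `H_η`: the horizontal space at `η`. -/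
def horizontalSpace (η : TangentBundle (𝓡 7) X) : Submodule ℝ (TangentSpace (𝓡 7).tangent η) :=
  LinearMap.range (horizontalLift η).toLinearMap

/-- The distribution `𝓔_η = π_*⁻¹(⟨η⟩^⊥) ⊆ T_η Z₇`. -/
def contactSpace (η : TangentBundle (𝓡 7) X) : Submodule ℝ (TangentSpace (𝓡 7).tangent η) :=
  unitTangent η ⊓ (perp η).comap (projDeriv η).toLinearMap

/-- The horizontal summand `E^H_η` of `𝓔_η`: the part of `H_η` over `⟨η⟩^⊥`. -/
def horizontalContact (η : TangentBundle (𝓡 7) X) :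
    Submodule ℝ (TangentSpace (𝓡 7).tangent η) :=
  horizontalSpace η ⊓ (perp η).comap (projDeriv η).toLinearMap


lemma verticalSpace_le_contactSpace (η : TangentBundle (𝓡 7) X) :
    verticalSpace η ≤ contactSpace η := by
  rintro w ⟨h1, h2⟩
  refine ⟨h1, ?_⟩
  change projDeriv η w ∈ perp η
  rw [show projDeriv η w = 0 from h2]
  exact zero_mem _

lemma horizontalContact_le_contactSpace (η : TangentBundle (𝓡 7) X) :
    horizontalContact η ≤ contactSpace η := by
  rintro w ⟨⟨v, rfl⟩, h⟩
  exact ⟨horizontalLift_mem η v, h⟩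

/-- The isomorphism of `E_η` with `E^H_η` given by the horizontal lift; its inverse is `π_*`. -/
def horizontalEquiv (η : TangentBundle (𝓡 7) X) : perp η ≃ₗ[ℝ] horizontalContact η :=
  LinearEquiv.ofLinearMap
    (((horizontalLift η).toLinearMap ∘ₗ (perp η).subtype).codRestrict (horizontalContact η)
      (fun v => ⟨⟨v.1, rfl⟩, by
        change projDeriv η (horizontalLift η v.1) ∈ perp η
        rw [projDeriv_horizontalLift]; exact v.2⟩))
    (((projDeriv η).toLinearMap ∘ₗ (horizontalContact η).subtype).codRestrict (perp η)
      (fun w => w.2.2))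
    (by
      ext ⟨w, ⟨v, rfl⟩, h⟩
      exact congrArg (horizontalLift η) (projDeriv_horizontalLift η v))
    (by
      ext v
      exact congrArg (fun a => a) (projDeriv_horizontalLift η v.1))

/-- The horizontal component of vectors in `𝓔_η`: the projection `𝓔_η → E^H_η` along the vertical
summand, which sends `w` to the horizontal lift of `π_* w`. -/
def horizontalComponent (η : TangentBundle (𝓡 7) X) : contactSpace η →ₗ[ℝ] horizontalContact η :=
  (horizontalEquiv η).toLinearMap ∘ₗ
    ((projDeriv η).toLinearMap ∘ₗ (contactSpace η).subtype).codRestrict (perp η) (fun w => w.2.2)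

/-- `horizontalComponent` is the projection for the decomposition `𝓔_η = E^V_η + E^H_η`. -/
lemma sub_horizontalComponent_mem (η : TangentBundle (𝓡 7) X) (w : contactSpace η) :
    (w : TangentSpace (𝓡 7).tangent η) - horizontalComponent η w ∈ verticalSpace η := by
  refine ⟨sub_mem w.2.1 (horizontalContact_le_contactSpace η (horizontalComponent η w).2).1, ?_⟩
  change projDeriv η (w.1 - horizontalLift η (projDeriv η w.1)) = 0
  rw [map_sub, projDeriv_horizontalLift, sub_self]

/-- The complex structure `𝒥` on `E_η = ⟨η⟩^⊥`: `⟨𝒥 v, w⟩ = φ(η, v, w)`, that is, `𝒥 v = η × v`. -/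
def perpJ (φ : ∀ x : X, TangentSpace (𝓡 7) x [⋀^Fin 3]→L[ℝ] ℝ) (η : TangentBundle (𝓡 7) X) :
    perp η →ₗ[ℝ] perp η :=
  (crossLeft φ η.2).restrict (fun v _ => by
    rw [perp, Submodule.mem_orthogonal_singleton_iff_inner_right]
    change ⟪η.2, cross φ η.2 v⟫ = 0
    rw [inner_cross]
    exact (φ η.1).map_eq_zero_of_eq ![η.2, η.2, v] (i := 0) (j := 1) rfl (by decide))

/-- The complex structure `𝒥` on `E^H_η`, transported from `E_η` by the isomorphism `π_*`. -/
def horizontalJ (φ : ∀ x : X, TangentSpace (𝓡 7) x [⋀^Fin 3]→L[ℝ] ℝ)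
    (η : TangentBundle (𝓡 7) X) : horizontalContact η →ₗ[ℝ] horizontalContact η :=
  (horizontalEquiv η).toLinearMap ∘ₗ perpJ φ η ∘ₗ (horizontalEquiv η).symm.toLinearMap

/-! ### Surfaces and the Gauss lift -/

variable {S : Type*} [TopologicalSpace S] [ChartedSpace (EuclideanSpace ℝ (Fin 2)) S]
  [IsManifold (𝓡 2) ∞ S]

/-- `o` is an orientation of the surface `S`: an orientation of each tangent space such that near
each point there is a smooth oriented frame. -/
def IsSurfaceOrientation (o : ∀ p : S, Orientation ℝ (TangentSpace (𝓡 2) p) (Fin 2)) : Prop :=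
  ∀ p : S, ∃ U : Set S, IsOpen U ∧ p ∈ U ∧ ∃ V : Fin 2 → ∀ q : S, TangentSpace (𝓡 2) q,
    (∀ i, ContMDiffOn (𝓡 2) (𝓡 2).tangent ∞
      (fun q => (⟨q, V i q⟩ : TangentBundle (𝓡 2) S)) U) ∧
    ∀ q ∈ U, ∃ b : Basis (Fin 2) ℝ (TangentSpace (𝓡 2) q),
      (∀ i, b i = V i q) ∧ b.orientation = o q

/-- Smooth immersions of a surface in `X`. -/
def IsImmersedSurface (f : S → X) : Prop :=
  ContMDiff (𝓡 2) (𝓡 7) ∞ f ∧ ∀ p : S, Function.Injective (mfderiv (𝓡 2) (𝓡 7) f p)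

variable [RiemannianBundle (fun p : S => TangentSpace (𝓡 2) p)]

/-- `f` is conformal: the pull-back by `f` of the metric of `X` is a positive multiple of the metric
of `S`. -/
def IsConformal (f : S → X) : Prop :=
  ∃ ρ : S → ℝ, (∀ p, 0 < ρ p) ∧ ∀ (p : S) (v w : TangentSpace (𝓡 2) p),
    ⟪(mfderiv (𝓡 2) (𝓡 7) f p v : TangentSpace (𝓡 7) (f p)),
      (mfderiv (𝓡 2) (𝓡 7) f p w : TangentSpace (𝓡 7) (f p))⟫ = ρ p * ⟪v, w⟫

instance finrank_tangentSpace (p : S) : Fact (finrank ℝ (TangentSpace (𝓡 2) p) = 2) :=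
  ⟨finrank_euclideanSpace_fin⟩

/-- The complex structure of an oriented Riemannian surface: rotation by a right angle. -/
def surfaceJ (o : ∀ p : S, Orientation ℝ (TangentSpace (𝓡 2) p) (Fin 2)) (p : S) :
    TangentSpace (𝓡 2) p →ₗ[ℝ] TangentSpace (𝓡 2) p :=
  (o p).rightAngleRotation.toLinearEquiv.toLinearMap

/-- For an oriented basis `(e₀, e₁)` of `T_p S` the vector `f_* e₀ × f_* e₁`; its positive multiples
do not depend on the basis. -/
def gaussNormal (φ : ∀ x : X, TangentSpace (𝓡 7) x [⋀^Fin 3]→L[ℝ] ℝ)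
    (o : ∀ p : S, Orientation ℝ (TangentSpace (𝓡 2) p) (Fin 2)) (f : S → X) (p : S) :
    TangentSpace (𝓡 7) (f p) :=
  let e := (o p).finOrthonormalBasis two_pos (finrank_tangentSpace p).out
  cross φ (mfderiv (𝓡 2) (𝓡 7) f p (e 0)) (mfderiv (𝓡 2) (𝓡 7) f p (e 1))

/-- The 7-dimensional Gauss lift `f̃₇ : S → Z₇ ⊆ TX`. -/
def gaussLift (φ : ∀ x : X, TangentSpace (𝓡 7) x [⋀^Fin 3]→L[ℝ] ℝ)
    (o : ∀ p : S, Orientation ℝ (TangentSpace (𝓡 2) p) (Fin 2)) (f : S → X) (p : S) :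
    TangentBundle (𝓡 7) X :=
  ⟨f p, ‖gaussNormal φ o f p‖⁻¹ • gaussNormal φ o f p⟩

/-- The Gauss lift sends `p` to `y × z`, where `(y, z)` is any oriented orthonormal basis of the plane
`f_*(T_p S)`. -/
lemma gaussLift_eq {φ : ∀ x : X, TangentSpace (𝓡 7) x [⋀^Fin 3]→L[ℝ] ℝ}
    (hφ : IsG2Manifold φ) (o : ∀ p : S, Orientation ℝ (TangentSpace (𝓡 2) p) (Fin 2)) (f : S → X)
    (p : S) (b : Basis (Fin 2) ℝ (TangentSpace (𝓡 2) p)) (hb : b.orientation = o p)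
    (y z : TangentSpace (𝓡 7) (f p)) (hy : y = mfderiv (𝓡 2) (𝓡 7) f p (b 0))
    (hz : z = mfderiv (𝓡 2) (𝓡 7) f p (b 1)) (hy1 : ‖y‖ = 1) (hz1 : ‖z‖ = 1) (hyz : ⟪y, z⟫ = 0) :
    gaussLift φ o f p = ⟨f p, cross φ y z⟩ := by
  have hn : ‖cross φ y z‖ = 1 := by
    have := norm_cross_sq hφ y z
    rw [hy1, hz1, hyz] at this
    rw [← sq_eq_sq₀ (norm_nonneg _) zero_le_one, this]; norm_num
  suffices h : ∃ c : ℝ, 0 < c ∧ gaussNormal φ o f p = c • cross φ y z by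
    obtain ⟨c, hc, h⟩ := h
    rw [gaussLift, h, norm_smul, hn, Real.norm_of_nonneg hc.le, mul_one, smul_smul,
      inv_mul_cancel₀ hc.ne', one_smul]
  set e := (o p).finOrthonormalBasis two_pos (finrank_tangentSpace p).out with he
  have hdet : 0 < b.det e := by
    rw [← OrthonormalBasis.coe_toBasis, ← Basis.orientation_eq_iff_det_pos, hb, he, Orientation.finOrthonormalBasis_orientation]
  have hdet2 : b.det e = b.repr (e 0) 0 * b.repr (e 1) 1 - b.repr (e 1) 0 * b.repr (e 0) 1 := by
    rw [Basis.det_apply, Matrix.det_fin_two]; simp [Basis.toMatrix_apply]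
  refine ⟨b.det e, hdet, ?_⟩
  have hfe (i : Fin 2) : (mfderiv (𝓡 2) (𝓡 7) f p (e i) : TangentSpace (𝓡 7) (f p)) =
      b.repr (e i) 0 • y + b.repr (e i) 1 • z := by
    rw [hy, hz, ← (mfderiv (𝓡 2) (𝓡 7) f p).map_smul, ← (mfderiv (𝓡 2) (𝓡 7) f p).map_smul,
      ← (mfderiv (𝓡 2) (𝓡 7) f p).map_add]
    congr 1
    exact ((Fin.sum_univ_two (fun j => b.repr (e i) j • b j)).symm.trans (b.sum_repr (e i))).symm
  change cross φ (mfderiv (𝓡 2) (𝓡 7) f p (e 0) : TangentSpace (𝓡 7) (f p))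
    (mfderiv (𝓡 2) (𝓡 7) f p (e 1) : TangentSpace (𝓡 7) (f p)) = _
  rw [hfe, hfe, hdet2]
  have key (a b c d : ℝ) : cross φ (a • y + b • z) (c • y + d • z) = (a * d - c * b) • cross φ y z := by
    have l1 (s t : ℝ) (m n k : TangentSpace (𝓡 7) (f p)) :
        cross φ k (s • m + t • n) = s • cross φ k m + t • cross φ k n := by
      change crossLeft φ k _ = s • crossLeft φ k m + t • crossLeft φ k n
      simp
    have sk (m n : TangentSpace (𝓡 7) (f p)) : cross φ m n = - cross φ n m := by
      refine ext_inner_left ℝ fun u => ?_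
      rw [inner_neg_right, inner_cross, inner_cross, eq_neg_iff_add_eq_zero,
        show ![u, m, n] = ![u, n, m] ∘ Equiv.swap 1 2 by ext1 i; fin_cases i <;> rfl]
      exact (φ (f p)).map_swap_add ![u, n, m] (i := 1) (j := 2) (by decide)
    have s0 (m : TangentSpace (𝓡 7) (f p)) : cross φ m m = 0 := by
      refine ext_inner_left ℝ fun u => ?_
      rw [inner_cross, inner_zero_right]
      exact (φ (f p)).map_eq_zero_of_eq ![u, m, m] (i := 1) (j := 2) rfl (by decide)
    rw [l1, sk _ y, sk _ z, l1, l1, s0, s0, sk z y]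
    module
  exact key _ _ _ _

end G2

end

end G2Geom

open G2Geom

/-!
The projection `π ∘ f̃₇` is `f`, so the horizontal component of `f̃₇_* v` is the horizontal lift of
`f_* v`. As horizontal lifting is injective and intertwines the two complex structures `𝒥`,
complex linearity of the horizontal component at `p` says that
`f_* (J v) = η × f_* v` for all `v ∈ T_p S`, where `η = f̃₇(p)`
(`horizontalComponent_eq_horizontalJ_iff`, `projDeriv_mfderiv_gaussLift`).

Take an oriented orthonormal basis `e₀`, `e₁` of `T_p S` and put `a = f_* e₀`, `b = f_* e₁`, so that
`η = (a × b) / |a × b|`. Polarizing `|y × z|² = |y ∧ z|²` gives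
`y × (y × z) = ⟨y, z⟩ y - |y|² z` (`cross_cross`), hence
`η × a = (|a|² b - ⟨a, b⟩ a) / |a × b|` and `η × b = (⟨a, b⟩ b - |b|² a) / |a × b|`. By linear
independence of `a` and `b`, the conditions `b = η × a` and `-a = η × b` hold if and only if
`⟨a, b⟩ = 0` and `|a|² = |b|²` (`unit_cross_eq_iff`), which is conformality at `p`
(`mfderiv_surfaceJ_iff`).

The remaining point is smoothness of the lift. A map to a Riemannian vector bundle is smooth once
its inner products with smooth local sections are, by Cramer's rule for the Gram matrix of a local
frame (`contMDiffAt_of_inner_sections`). The inner product of a section `W` with `y × z` is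
`φ(W, y, z)`, so cross products of smooth vector fields along a map are smooth
(`contMDiffAt_cross`). The derivative of the lift lies in `𝓔` because the lift has unit length and
is orthogonal to the image of `f_*` (`mfderiv_gaussLift_mem_contactSpace`).
-/

namespace G2Geom

open FiberBundle Module

section Cross

variable {X : Type*} [TopologicalSpace X] [ChartedSpace (EuclideanSpace ℝ (Fin 7)) X]
  [IsManifold (𝓡 7) ∞ X] [RiemannianBundle (fun x : X => TangentSpace (𝓡 7) x)]
  [IsContMDiffRiemannianBundle (𝓡 7) ∞ (EuclideanSpace ℝ (Fin 7))
    (fun x : X => TangentSpace (𝓡 7) x)]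

/-! ### Algebra of the cross product -/

lemma cross_swap (φ : ∀ x : X, TangentSpace (𝓡 7) x [⋀^Fin 3]→L[ℝ] ℝ) {x : X}
    (y z : TangentSpace (𝓡 7) x) : cross φ y z = -cross φ z y := by
  refine ext_inner_left ℝ fun u => ?_
  rw [inner_neg_right, inner_cross, inner_cross, eq_neg_iff_add_eq_zero,
    show ![u, y, z] = ![u, z, y] ∘ Equiv.swap 1 2 by ext1 i; fin_cases i <;> rfl]
  exact (φ x).map_swap_add ![u, z, y] (i := 1) (j := 2) (by decide)

/-- The cross product as a bilinear map. -/
noncomputable def crossBilin (φ : ∀ x : X, TangentSpace (𝓡 7) x [⋀^Fin 3]→L[ℝ] ℝ) (x : X) :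
    TangentSpace (𝓡 7) x →ₗ[ℝ] TangentSpace (𝓡 7) x →ₗ[ℝ] TangentSpace (𝓡 7) x where
  toFun := crossLeft φ
  map_add' y y' := by
    ext1 z
    change cross φ (y + y') z = cross φ y z + cross φ y' z
    rw [cross_swap φ (y + y'), cross_swap φ y, cross_swap φ y', ← neg_add]
    exact congrArg Neg.neg ((crossLeft φ z).map_add y y')
  map_smul' c y := by
    ext1 z
    change cross φ (c • y) z = c • cross φ y z
    rw [cross_swap φ (c • y), cross_swap φ y, smul_neg]
    exact congrArg Neg.neg ((crossLeft φ z).map_smul c y)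

lemma crossBilin_apply (φ : ∀ x : X, TangentSpace (𝓡 7) x [⋀^Fin 3]→L[ℝ] ℝ) {x : X}
    (y z : TangentSpace (𝓡 7) x) : crossBilin φ x y z = cross φ y z := rfl

lemma inner_left_cross (φ : ∀ x : X, TangentSpace (𝓡 7) x [⋀^Fin 3]→L[ℝ] ℝ) {x : X}
    (y z : TangentSpace (𝓡 7) x) : ⟪y, cross φ y z⟫ = 0 := by
  rw [inner_cross]
  exact (φ x).map_eq_zero_of_eq ![y, y, z] (i := 0) (j := 1) rfl (by decide)

lemma inner_right_cross (φ : ∀ x : X, TangentSpace (𝓡 7) x [⋀^Fin 3]→L[ℝ] ℝ) {x : X}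
    (y z : TangentSpace (𝓡 7) x) : ⟪z, cross φ y z⟫ = 0 := by
  rw [cross_swap, inner_neg_right, inner_left_cross, neg_zero]

lemma inner_cross_swap (φ : ∀ x : X, TangentSpace (𝓡 7) x [⋀^Fin 3]→L[ℝ] ℝ) {x : X}
    (u y z : TangentSpace (𝓡 7) x) : ⟪u, cross φ y z⟫ = -⟪cross φ y u, z⟫ := by
  rw [real_inner_comm z, inner_cross, inner_cross, eq_neg_iff_add_eq_zero,
    show ![u, y, z] = ![z, y, u] ∘ Equiv.swap 0 2 by ext1 i; fin_cases i <;> rfl]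
  exact (φ x).map_swap_add ![z, y, u] (i := 0) (j := 2) (by decide)

/-- The double cross product. It is the polarization of `|y × z|² = |y|² |z|² - ⟨y, z⟩²` in `z`. -/
lemma cross_cross {φ : ∀ x : X, TangentSpace (𝓡 7) x [⋀^Fin 3]→L[ℝ] ℝ}
    (hφ : IsG2Manifold φ) {x : X} (y z : TangentSpace (𝓡 7) x) :
    cross φ y (cross φ y z) = ⟪y, z⟫ • y - ‖y‖ ^ 2 • z := by
  refine ext_inner_left ℝ fun w => ?_
  rw [inner_cross_swap, inner_sub_right, inner_smul_right, inner_smul_right]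
  have h := norm_cross_sq hφ y (w + z)
  have h1 := norm_cross_sq hφ y w
  have h2 := norm_cross_sq hφ y z
  rw [← crossBilin_apply, map_add, crossBilin_apply, crossBilin_apply, norm_add_sq_real,
    norm_add_sq_real, inner_add_right] at h
  rw [real_inner_comm y w]
  linear_combination (-1 / 2 : ℝ) * h + (1 / 2 : ℝ) * h1 + (1 / 2 : ℝ) * h2

/-- If `y × z = 0`, then `y × (y × z) = 0` is a linear relation between `y` and `z`. -/
lemma cross_ne_zero {φ : ∀ x : X, TangentSpace (𝓡 7) x [⋀^Fin 3]→L[ℝ] ℝ}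
    (hφ : IsG2Manifold φ) {x : X} {y z : TangentSpace (𝓡 7) x}
    (h : LinearIndependent ℝ ![y, z]) : cross φ y z ≠ 0 := by
  intro h0
  have h1 := cross_cross hφ y z
  rw [h0, ← crossBilin_apply, map_zero] at h1
  have h2 := LinearIndependent.pair_iff.1 h ⟪y, z⟫ (-‖y‖ ^ 2) (by rw [h1]; module)
  have hy : y = 0 := by simpa using h2.2
  exact h.ne_zero 0 hy

/-- Left multiplication by the unit vector `η` in the direction of `a × b` rotates the plane of
`a`, `b` through a right angle. So it maps `a` to `b` and `b` to `-a` exactly if these two vectors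
are orthogonal of the same length. -/
lemma unit_cross_eq_iff {φ : ∀ x : X, TangentSpace (𝓡 7) x [⋀^Fin 3]→L[ℝ] ℝ}
    (hφ : IsG2Manifold φ) {x : X} {a b : TangentSpace (𝓡 7) x}
    (h : LinearIndependent ℝ ![a, b]) :
    (b = cross φ (‖cross φ a b‖⁻¹ • cross φ a b) a ∧
      -a = cross φ (‖cross φ a b‖⁻¹ • cross φ a b) b) ↔
    ∃ ρ : ℝ, 0 < ρ ∧ ‖a‖ ^ 2 = ρ ∧ ‖b‖ ^ 2 = ρ ∧ ⟪a, b⟫ = 0 := by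
  have hN : 0 < ‖cross φ a b‖ := norm_pos_iff.2 (cross_ne_zero hφ h)
  have ha : 0 < ‖a‖ := norm_pos_iff.2 (h.ne_zero 0)
  have hsq := norm_cross_sq hφ a b
  set n := ‖cross φ a b‖ with hn
  have e1 : cross φ (n⁻¹ • cross φ a b) a = n⁻¹ • (‖a‖ ^ 2 • b - ⟪a, b⟫ • a) := by
    rw [cross_swap, ← crossBilin_apply, map_smul, crossBilin_apply, cross_cross hφ]
    module
  have e2 : cross φ (n⁻¹ • cross φ a b) b = n⁻¹ • (⟪a, b⟫ • b - ‖b‖ ^ 2 • a) := by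
    rw [cross_swap, ← crossBilin_apply, map_smul, crossBilin_apply, cross_swap φ a b,
      ← crossBilin_apply, map_neg, crossBilin_apply, cross_cross hφ, real_inner_comm]
    module
  rw [e1, e2]
  constructor
  · rintro ⟨h1, h2⟩
    obtain ⟨h3, h4⟩ := LinearIndependent.pair_iff.1 h (n⁻¹ * ⟪a, b⟫) (1 - n⁻¹ * ‖a‖ ^ 2)
      ((by module : _ = b - n⁻¹ • (‖a‖ ^ 2 • b - ⟪a, b⟫ • a)).trans (sub_eq_zero.2 h1))
    obtain ⟨h5, -⟩ := LinearIndependent.pair_iff.1 h (n⁻¹ * ‖b‖ ^ 2 - 1) (-(n⁻¹ * ⟪a, b⟫))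
      ((by module : _ = -a - n⁻¹ • (⟪a, b⟫ • b - ‖b‖ ^ 2 • a)).trans (sub_eq_zero.2 h2))
    have hn0 := hN.ne'
    refine ⟨n, hN, ?_, ?_, ?_⟩
    · field_simp at h4; linarith
    · field_simp at h5; linarith
    · simpa [hn0] using h3
  · rintro ⟨ρ, hρ, h1, h2, h3⟩
    rw [h1, h2, h3] at hsq
    -- `|a × b|² = ρ²` for orthogonal vectors with squared length `ρ`
    have : n = ρ := by
      rw [← sq_eq_sq₀ hN.le hρ.le, hsq]; ring
    rw [this, h1, h2, h3]
    constructor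
    · rw [zero_smul, sub_zero, smul_smul, inv_mul_cancel₀ hρ.ne', one_smul]
    · rw [zero_smul, zero_sub, smul_neg, smul_smul, inv_mul_cancel₀ hρ.ne', one_smul]

/-- The horizontal component of `w'` is `𝒥` of that of `w` if and only if this holds for the
projections to the tangent space of the base. -/
lemma horizontalComponent_eq_horizontalJ_iff
    (φ : ∀ x : X, TangentSpace (𝓡 7) x [⋀^Fin 3]→L[ℝ] ℝ) (η : TangentBundle (𝓡 7) X)
    (w w' : contactSpace η) :
    horizontalComponent η w' = horizontalJ φ η (horizontalComponent η w) ↔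
      projDeriv η w' = cross φ η.2 (projDeriv η w) := by
  simp only [horizontalComponent, horizontalJ, LinearMap.comp_apply, LinearEquiv.coe_coe,
    LinearEquiv.symm_apply_apply]
  rw [(horizontalEquiv η).injective.eq_iff, Subtype.ext_iff]
  rfl

end Cross

section Smoothness

/-! ### Smoothness criterion in Riemannian vector bundles -/

variable
  {EB : Type*} [NormedAddCommGroup EB] [NormedSpace ℝ EB]
  {HB : Type*} [TopologicalSpace HB] {IB : ModelWithCorners ℝ EB HB} {n : ℕ∞ω}
  {B : Type*} [TopologicalSpace B] [ChartedSpace HB B]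
  {F : Type*} [NormedAddCommGroup F] [NormedSpace ℝ F] [FiniteDimensional ℝ F]
  {V : B → Type*} [TopologicalSpace (TotalSpace F V)]
  [∀ x, NormedAddCommGroup (V x)] [∀ x, InnerProductSpace ℝ (V x)]
  [FiberBundle F V] [VectorBundle ℝ F V]
  {EM : Type*} [NormedAddCommGroup EM] [NormedSpace ℝ EM]
  {HM : Type*} [TopologicalSpace HM] {IM : ModelWithCorners ℝ EM HM}
  {M : Type*} [TopologicalSpace M] [ChartedSpace HM M]
  {b : M → B} {m₀ : M}

lemma _root_.ContMDiffAt.matrix_det {ι : Type*} [Fintype ι] [DecidableEq ι]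
    {A : M → Matrix ι ι ℝ} (h : ∀ i j, ContMDiffAt IM 𝓘(ℝ, ℝ) n (fun m => A m i j) m₀) :
    ContMDiffAt IM 𝓘(ℝ, ℝ) n (fun m => (A m).det) m₀ := by
  simp only [Matrix.det_apply']
  exact contMDiffAt_finsetSum fun σ _ =>
    contMDiffAt_const.mul (contMDiffAt_finsetProd fun i _ => h _ _)

/-- A map to a Riemannian vector bundle is smooth if its base map and its inner products with
smooth local sections are: the coefficients in a local frame are obtained from these inner products
by Cramer's rule for the Gram matrix of the frame. -/
lemma contMDiffAt_of_inner_sections [IsContMDiffRiemannianBundle IB n F V]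
    [ContMDiffVectorBundle n F V IB]
    (hb : ContMDiffAt IM IB n b m₀) {v : ∀ m, V (b m)}
    (hv : ∀ W : ∀ x, V x,
      ContMDiffAt IB (IB.prod 𝓘(ℝ, F)) n (fun x => (⟨x, W x⟩ : TotalSpace F V)) (b m₀) →
        ContMDiffAt IM 𝓘(ℝ, ℝ) n (fun m => ⟪W (b m), v m⟫) m₀) :
    ContMDiffAt IM (IB.prod 𝓘(ℝ, F)) n (fun m => (⟨b m, v m⟩ : TotalSpace F V)) m₀ := by
  rw [contMDiffAt_totalSpace]
  refine ⟨hb, ?_⟩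
  set t := trivializationAt F V (b m₀)
  let β := finBasis ℝ F
  have hmem : b m₀ ∈ t.baseSet := FiberBundle.mem_baseSet_trivializationAt' (b m₀)
  have hsec (i) : ContMDiffAt IB (IB.prod 𝓘(ℝ, F)) n
      (fun x => (⟨x, t.localFrame β i x⟩ : TotalSpace F V)) (b m₀) :=
    contMDiffAt_localFrame_of_mem n t β i hmem
  let G (m : M) : Matrix (Fin (finrank ℝ F)) (Fin (finrank ℝ F)) ℝ :=
    Matrix.gram ℝ (fun i => t.localFrame β i (b m))
  let r (m : M) (i : Fin (finrank ℝ F)) : ℝ := ⟪t.localFrame β i (b m), v m⟫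
  have hr (i) : ContMDiffAt IM 𝓘(ℝ, ℝ) n (fun m => r m i) m₀ := hv _ (hsec i)
  have hG (i j) : ContMDiffAt IM 𝓘(ℝ, ℝ) n (fun m => G m i j) m₀ :=
    ContMDiffAt.inner_bundle (IB := IB) (F := F) (E := V) ((hsec i).comp m₀ hb)
      ((hsec j).comp m₀ hb)
  have hdet (m : M) (hm : b m ∈ t.baseSet) : (G m).det ≠ 0 := by
    have hli : LinearIndependent ℝ (fun i => t.localFrame β i (b m)) :=
      (t.isLocalFrameOn_localFrame_baseSet IB n β).linearIndependent hm
    exact (Matrix.posDef_gram_of_linearIndependent hli).det_pos.ne'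
  have hcoef (m : M) (hm : b m ∈ t.baseSet) : (t ⟨b m, v m⟩).2 =
      ∑ i, ((G m).det⁻¹ * ((G m).updateCol i (r m)).det) • β i := by
    let c : Fin (finrank ℝ F) → ℝ := β.repr (t ⟨b m, v m⟩).2
    have hvm : v m = ∑ j, c j • t.localFrame β j (b m) := by
      have := ((t.basisAt β hm).sum_repr (v m)).symm
      simpa [c, hm, Trivialization.basisAt] using this
    have hGr : r m = (G m).mulVec c := by
      ext i
      simp only [r, hvm, inner_sum, inner_smul_right, Matrix.mulVec, dotProduct, G,
        Matrix.gram_apply]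
      exact Finset.sum_congr rfl fun j _ => mul_comm _ _
    refine (β.sum_repr _).symm.trans (Finset.sum_congr rfl fun i _ => ?_)
    congr 1
    have h1 : ((G m).updateCol i (r m)).det = (G m).det * c i := by
      rw [← Matrix.cramer_apply, Matrix.cramer_eq_adjugate_mulVec, hGr, Matrix.mulVec_mulVec,
        Matrix.adjugate_mul, Matrix.smul_mulVec, Matrix.one_mulVec]
      rfl
    rw [h1, inv_mul_cancel_left₀ (hdet m hm)]
  have hsm : ContMDiffAt IM 𝓘(ℝ, F) n
      (fun m => ∑ i, ((G m).det⁻¹ * ((G m).updateCol i (r m)).det) • β i) m₀ := by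
    have h1 : ContMDiffAt IM 𝓘(ℝ, ℝ) n (fun m => (G m).det⁻¹) m₀ :=
      (ContMDiffAt.matrix_det hG).inv₀ (hdet m₀ hmem)
    have h2 (i) : ContMDiffAt IM 𝓘(ℝ, ℝ) n (fun m => ((G m).updateCol i (r m)).det) m₀ := by
      refine ContMDiffAt.matrix_det fun j k => ?_
      by_cases hk : k = i
      · simpa [Matrix.updateCol_apply, hk] using hr j
      · simpa [Matrix.updateCol_apply, hk] using hG j k
    exact contMDiffAt_finsetSum fun i _ => (h1.mul (h2 i)).smul contMDiffAt_const
  exact hsm.congr_of_eventuallyEq ((hb.continuousAt.eventually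
    (t.open_baseSet.mem_nhds hmem)).mono hcoef)

end Smoothness

section GaussLift

variable {X : Type*} [TopologicalSpace X] [ChartedSpace (EuclideanSpace ℝ (Fin 7)) X]
  [IsManifold (𝓡 7) ∞ X] [RiemannianBundle (fun x : X => TangentSpace (𝓡 7) x)]
  [IsContMDiffRiemannianBundle (𝓡 7) ∞ (EuclideanSpace ℝ (Fin 7))
    (fun x : X => TangentSpace (𝓡 7) x)]

/-! ### Smoothness of cross products along a map -/

section Along

variable {EM : Type*} [NormedAddCommGroup EM] [NormedSpace ℝ EM]
  {HM : Type*} [TopologicalSpace HM] {IM : ModelWithCorners ℝ EM HM}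
  {M : Type*} [TopologicalSpace M] [ChartedSpace HM M] {b : M → X} {m₀ : M}

/-- `φ(W, y, z)` is smooth for a smooth local vector field `W` and vector fields `y`, `z` along
a smooth map: expand `y` and `z` in a local frame. -/
lemma contMDiffAt_inner_cross {φ : ∀ x : X, TangentSpace (𝓡 7) x [⋀^Fin 3]→L[ℝ] ℝ}
    (hφ : IsG2Manifold φ) {y z : ∀ m, TangentSpace (𝓡 7) (b m)}
    (hy : ContMDiffAt IM (𝓡 7).tangent ∞ (fun m => (⟨b m, y m⟩ : TangentBundle (𝓡 7) X)) m₀)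
    (hz : ContMDiffAt IM (𝓡 7).tangent ∞ (fun m => (⟨b m, z m⟩ : TangentBundle (𝓡 7) X)) m₀)
    {W : ∀ x : X, TangentSpace (𝓡 7) x} (hW : SmoothAt W (b m₀)) :
    ContMDiffAt IM 𝓘(ℝ, ℝ) ∞ (fun m => ⟪W (b m), cross φ (y m) (z m)⟫) m₀ := by
  have hy' := contMDiffAt_totalSpace.1 hy
  have hz' := contMDiffAt_totalSpace.1 hz
  have hb : ContMDiffAt IM (𝓡 7) ∞ b m₀ := hy'.1
  set t := trivializationAt (EuclideanSpace ℝ (Fin 7)) (TangentSpace (𝓡 7) : X → Type _) (b m₀)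
  let β := finBasis ℝ (EuclideanSpace ℝ (Fin 7))
  have hmem : b m₀ ∈ t.baseSet := FiberBundle.mem_baseSet_trivializationAt' (b m₀)
  have hsec (i) : SmoothAt (t.localFrame β i) (b m₀) :=
    contMDiffAt_localFrame_of_mem ∞ t β i hmem
  have hcoef {v : ∀ m, TangentSpace (𝓡 7) (b m)}
      (hv : ContMDiffAt IM 𝓘(ℝ, EuclideanSpace ℝ (Fin 7)) ∞ (fun m => (t ⟨b m, v m⟩).2) m₀) (i) :
      ContMDiffAt IM 𝓘(ℝ, ℝ) ∞ (fun m => β.repr (t ⟨b m, v m⟩).2 i) m₀ :=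
    (LinearMap.toContinuousLinearMap (β.coord i)).contDiff.contMDiff.contMDiffAt.comp m₀ hv
  have hexp (m : M) (hm : b m ∈ t.baseSet) (v : TangentSpace (𝓡 7) (b m)) :
      v = ∑ j, β.repr (t ⟨b m, v⟩).2 j • t.localFrame β j (b m) := by
    have := ((t.basisAt β hm).sum_repr v).symm
    simpa [hm, Trivialization.basisAt] using this
  have hterm (j k) : ContMDiffAt IM 𝓘(ℝ, ℝ) ∞
      (fun m => β.repr (t ⟨b m, y m⟩).2 j * (β.repr (t ⟨b m, z m⟩).2 k *
        φ (b m) ![W (b m), t.localFrame β j (b m), t.localFrame β k (b m)])) m₀ :=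
    (hcoef hy'.2 j).mul ((hcoef hz'.2 k).mul
      ((hφ.smooth _ _ _ _ hW (hsec j) (hsec k)).comp m₀ hb))
  have hsum : ContMDiffAt IM 𝓘(ℝ, ℝ) ∞
      (fun m => ∑ j, ∑ k, β.repr (t ⟨b m, y m⟩).2 j * (β.repr (t ⟨b m, z m⟩).2 k *
        φ (b m) ![W (b m), t.localFrame β j (b m), t.localFrame β k (b m)])) m₀ :=
    contMDiffAt_finsetSum fun j _ => contMDiffAt_finsetSum fun k _ => hterm j k
  refine hsum.congr_of_eventuallyEq ((hb.continuousAt.eventually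
    (t.open_baseSet.mem_nhds hmem)).mono fun m hm => ?_)
  beta_reduce
  rw [← crossBilin_apply]
  conv_lhs => rw [hexp m hm (y m), hexp m hm (z m)]
  simp only [map_sum, map_smul, LinearMap.sum_apply, LinearMap.smul_apply, inner_sum,
    inner_smul_right, crossBilin_apply, inner_cross, Finset.mul_sum]
  rw [Finset.sum_comm]
  exact Finset.sum_congr rfl fun j _ => Finset.sum_congr rfl fun k _ => mul_left_comm _ _ _

lemma contMDiffAt_cross {φ : ∀ x : X, TangentSpace (𝓡 7) x [⋀^Fin 3]→L[ℝ] ℝ}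
    (hφ : IsG2Manifold φ) {y z : ∀ m, TangentSpace (𝓡 7) (b m)}
    (hy : ContMDiffAt IM (𝓡 7).tangent ∞ (fun m => (⟨b m, y m⟩ : TangentBundle (𝓡 7) X)) m₀)
    (hz : ContMDiffAt IM (𝓡 7).tangent ∞ (fun m => (⟨b m, z m⟩ : TangentBundle (𝓡 7) X)) m₀) :
    ContMDiffAt IM (𝓡 7).tangent ∞
      (fun m => (⟨b m, cross φ (y m) (z m)⟩ : TangentBundle (𝓡 7) X)) m₀ :=
  contMDiffAt_of_inner_sections (contMDiffAt_totalSpace.1 hy).1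
    fun _ hW => contMDiffAt_inner_cross hφ hy hz hW

/-- Normalization keeps a vector field along a map smooth where it does not vanish. -/
lemma contMDiffAt_normalize {v : ∀ m, TangentSpace (𝓡 7) (b m)}
    (hv : ContMDiffAt IM (𝓡 7).tangent ∞ (fun m => (⟨b m, v m⟩ : TangentBundle (𝓡 7) X)) m₀)
    (h0 : v m₀ ≠ 0) :
    ContMDiffAt IM (𝓡 7).tangent ∞
      (fun m => (⟨b m, ‖v m‖⁻¹ • v m⟩ : TangentBundle (𝓡 7) X)) m₀ := by
  have hb := (contMDiffAt_totalSpace.1 hv).1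
  refine contMDiffAt_of_inner_sections hb fun W hW => ?_
  simp only [inner_smul_right]
  refine ContMDiffAt.mul (ContMDiffAt.inv₀ ?_ (norm_ne_zero_iff.2 h0)) ?_
  · have h : ContMDiffAt IM 𝓘(ℝ, ℝ) ∞ (fun m => ⟪v m, v m⟫) m₀ :=
      ContMDiffAt.inner_bundle (IB := 𝓡 7) (F := EuclideanSpace ℝ (Fin 7))
        (E := fun x : X => TangentSpace (𝓡 7) x) hv hv
    have h1 : ContMDiffAt IM 𝓘(ℝ, ℝ) ∞ (fun m => √⟪v m, v m⟫) m₀ :=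
      (Real.contDiffAt_sqrt (inner_self_ne_zero.2 h0)).contMDiffAt.comp m₀ h
    refine h1.congr_of_eventuallyEq (.of_forall fun m => ?_)
    exact norm_eq_sqrt_real_inner _
  · exact ContMDiffAt.inner_bundle (IB := 𝓡 7) (F := EuclideanSpace ℝ (Fin 7))
      (E := fun x : X => TangentSpace (𝓡 7) x) (hW.comp m₀ hb) hv

end Along

/-! ### The Gauss lift -/

variable {S : Type*} [TopologicalSpace S] [ChartedSpace (EuclideanSpace ℝ (Fin 2)) S]
  [IsManifold (𝓡 2) ∞ S] [RiemannianBundle (fun p : S => TangentSpace (𝓡 2) p)]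

lemma linearIndependent_mfderiv {f : S → X} (hf : IsImmersedSurface f) {p : S}
    {v : Fin 2 → TangentSpace (𝓡 2) p} (hv : LinearIndependent ℝ v) :
    LinearIndependent ℝ (![mfderiv (𝓡 2) (𝓡 7) f p (v 0), mfderiv (𝓡 2) (𝓡 7) f p (v 1)] :
      Fin 2 → TangentSpace (𝓡 7) (f p)) := by
  refine LinearIndependent.pair_iff.2 fun s t hst => ?_
  have h : mfderiv (𝓡 2) (𝓡 7) f p (s • v 0 + t • v 1) = mfderiv (𝓡 2) (𝓡 7) f p 0 := by
    rw [map_add, map_smul, map_smul, map_zero]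
    exact hst
  have hv' : ![v 0, v 1] = v := by
    ext1 i
    fin_cases i <;> rfl
  exact LinearIndependent.pair_iff.1 (hv' ▸ hv :) s t (hf.2 p h)

/-- The vector `f_* b₀ × f_* b₁` for an oriented basis `b` has the direction of `gaussNormal`. -/
lemma exists_gaussNormal_eq_smul (φ : ∀ x : X, TangentSpace (𝓡 7) x [⋀^Fin 3]→L[ℝ] ℝ)
    (o : ∀ p : S, Orientation ℝ (TangentSpace (𝓡 2) p) (Fin 2)) (f : S → X) {p : S}
    {b : Basis (Fin 2) ℝ (TangentSpace (𝓡 2) p)} (hb : b.orientation = o p) :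
    ∃ c : ℝ, 0 < c ∧ gaussNormal φ o f p =
      c • cross φ (mfderiv (𝓡 2) (𝓡 7) f p (b 0)) (mfderiv (𝓡 2) (𝓡 7) f p (b 1)) := by
  set e := (o p).finOrthonormalBasis two_pos (finrank_tangentSpace p).out with he
  have hdet : 0 < b.det e := by
    rw [← OrthonormalBasis.coe_toBasis, ← Basis.orientation_eq_iff_det_pos, hb, he,
      Orientation.finOrthonormalBasis_orientation]
  refine ⟨b.det e, hdet, ?_⟩
  let B : TangentSpace (𝓡 2) p →ₗ[ℝ] TangentSpace (𝓡 2) p →ₗ[ℝ] TangentSpace (𝓡 7) (f p) :=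
    (crossBilin φ (f p)).compl₁₂ (mfderiv (𝓡 2) (𝓡 7) f p).toLinearMap
      (mfderiv (𝓡 2) (𝓡 7) f p).toLinearMap
  have hself (v) : B v v = 0 := by
    refine ext_inner_left ℝ fun u => ?_
    change ⟪u, cross φ _ _⟫ = _
    rw [inner_cross, inner_zero_right]
    exact (φ (f p)).map_eq_zero_of_eq _ (i := 1) (j := 2) rfl (by decide)
  have hswap : B (b 1) (b 0) = -B (b 0) (b 1) := cross_swap φ _ _
  have hexp (i : Fin 2) : e i = b.repr (e i) 0 • b 0 + b.repr (e i) 1 • b 1 :=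
    ((Fin.sum_univ_two (fun j => b.repr (e i) j • b j)).symm.trans (b.sum_repr (e i))).symm
  have hdet2 : b.det e = b.repr (e 0) 0 * b.repr (e 1) 1 - b.repr (e 1) 0 * b.repr (e 0) 1 := by
    rw [Basis.det_apply, Matrix.det_fin_two]; simp [Basis.toMatrix_apply]
  change B (e 0) (e 1) = b.det e • B (b 0) (b 1)
  rw [hdet2]
  conv_lhs => rw [hexp 0, hexp 1]
  simp only [map_add, map_smul, LinearMap.add_apply, LinearMap.smul_apply, hself, hswap]
  module

lemma gaussLift_eq_of_basis (φ : ∀ x : X, TangentSpace (𝓡 7) x [⋀^Fin 3]→L[ℝ] ℝ)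
    (o : ∀ p : S, Orientation ℝ (TangentSpace (𝓡 2) p) (Fin 2)) (f : S → X) {p : S}
    {b : Basis (Fin 2) ℝ (TangentSpace (𝓡 2) p)} (hb : b.orientation = o p)
    {N : TangentSpace (𝓡 7) (f p)}
    (hN : N = cross φ (mfderiv (𝓡 2) (𝓡 7) f p (b 0)) (mfderiv (𝓡 2) (𝓡 7) f p (b 1))) :
    gaussLift φ o f p = ⟨f p, ‖N‖⁻¹ • N⟩ := by
  obtain ⟨c, hc, h⟩ := exists_gaussNormal_eq_smul φ o f hb
  rw [← hN] at h
  rw [gaussLift, h, norm_smul, Real.norm_of_nonneg hc.le, smul_smul, mul_inv, mul_right_comm,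
    inv_mul_cancel₀ hc.ne', one_mul]

lemma gaussNormal_ne_zero {φ : ∀ x : X, TangentSpace (𝓡 7) x [⋀^Fin 3]→L[ℝ] ℝ}
    (hφ : IsG2Manifold φ) (o : ∀ p : S, Orientation ℝ (TangentSpace (𝓡 2) p) (Fin 2))
    {f : S → X} (hf : IsImmersedSurface f) (p : S) : gaussNormal φ o f p ≠ 0 :=
  cross_ne_zero hφ (linearIndependent_mfderiv hf
    ((o p).finOrthonormalBasis two_pos (finrank_tangentSpace p).out).orthonormal.linearIndependent)

lemma gaussLift_mem_unitTangentBundle {φ : ∀ x : X, TangentSpace (𝓡 7) x [⋀^Fin 3]→L[ℝ] ℝ}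
    (hφ : IsG2Manifold φ) (o : ∀ p : S, Orientation ℝ (TangentSpace (𝓡 2) p) (Fin 2))
    {f : S → X} (hf : IsImmersedSurface f) (p : S) :
    gaussLift φ o f p ∈ unitTangentBundle X := by
  change ‖‖gaussNormal φ o f p‖⁻¹ • gaussNormal φ o f p‖ = 1
  rw [norm_smul, norm_inv, norm_norm,
    inv_mul_cancel₀ (norm_ne_zero_iff.2 (gaussNormal_ne_zero hφ o hf p))]

lemma contMDiff_gaussLift {φ : ∀ x : X, TangentSpace (𝓡 7) x [⋀^Fin 3]→L[ℝ] ℝ}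
    (hφ : IsG2Manifold φ) {o : ∀ p : S, Orientation ℝ (TangentSpace (𝓡 2) p) (Fin 2)}
    (ho : IsSurfaceOrientation o) {f : S → X} (hf : IsImmersedSurface f) :
    ContMDiff (𝓡 2) (𝓡 7).tangent ∞ (gaussLift φ o f) := by
  intro p
  -- The orthonormal bases in the definition of the Gauss lift are chosen point by point and need not
  -- vary smoothly with the point; a local smooth oriented frame gives the same lift.
  obtain ⟨U, hU, hp, V, hV, hb⟩ := ho p
  have hdf (i) : ContMDiffAt (𝓡 2) (𝓡 7).tangent ∞
      (fun q => (⟨f q, mfderiv (𝓡 2) (𝓡 7) f q (V i q)⟩ : TangentBundle (𝓡 7) X)) p :=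
    (hf.1.contMDiff_tangentMap (m := ∞) le_rfl).contMDiffAt.comp p
      ((hV i).contMDiffAt (hU.mem_nhds hp))
  have hN := contMDiffAt_cross hφ (hdf 0) (hdf 1)
  refine (contMDiffAt_normalize hN ?_).congr_of_eventuallyEq
    (Filter.eventuallyEq_of_mem (hU.mem_nhds hp) fun q hq => ?_)
  · obtain ⟨b, hbV, -⟩ := hb p hp
    rw [← hbV, ← hbV]
    exact cross_ne_zero hφ (linearIndependent_mfderiv hf b.linearIndependent)
  · obtain ⟨b, hbV, hbo⟩ := hb q hq
    exact gaussLift_eq_of_basis φ o f hbo (by rw [hbV, hbV])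

lemma projDeriv_mfderiv_gaussLift {φ : ∀ x : X, TangentSpace (𝓡 7) x [⋀^Fin 3]→L[ℝ] ℝ}
    {o : ∀ p : S, Orientation ℝ (TangentSpace (𝓡 2) p) (Fin 2)} {f : S → X} {p : S}
    (h : MDifferentiableAt (𝓡 2) (𝓡 7).tangent (gaussLift φ o f) p)
    (v : TangentSpace (𝓡 2) p) :
    projDeriv (gaussLift φ o f p) (mfderiv (𝓡 2) (𝓡 7).tangent (gaussLift φ o f) p v) =
      mfderiv (𝓡 2) (𝓡 7) f p v :=
  (mfderiv_comp_apply (I := 𝓡 2) (I' := (𝓡 7).tangent) (I'' := 𝓡 7)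
    (g := fun ζ : TangentBundle (𝓡 7) X => ζ.1) p (mdifferentiableAt_proj _) h v).symm

/-- The image of `f_*` is orthogonal to the Gauss lift. -/
lemma mfderiv_mem_perp_gaussLift (φ : ∀ x : X, TangentSpace (𝓡 7) x [⋀^Fin 3]→L[ℝ] ℝ)
    (o : ∀ p : S, Orientation ℝ (TangentSpace (𝓡 2) p) (Fin 2)) (f : S → X) (p : S)
    (v : TangentSpace (𝓡 2) p) :
    mfderiv (𝓡 2) (𝓡 7) f p v ∈ perp (gaussLift φ o f p) := by
  refine (Submodule.mem_orthogonal_singleton_iff_inner_left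
    (𝕜 := ℝ) (E := TangentSpace (𝓡 7) (f p))).2 ?_
  set e := (o p).finOrthonormalBasis two_pos (finrank_tangentSpace p).out with he
  let L : TangentSpace (𝓡 2) p →ₗ[ℝ] TangentSpace (𝓡 7) (f p) :=
    (mfderiv (𝓡 2) (𝓡 7) f p).toLinearMap
  have h0 : ⟪L (e 0), gaussNormal φ o f p⟫ = 0 := inner_left_cross φ _ _
  have h1 : ⟪L (e 1), gaussNormal φ o f p⟫ = 0 := inner_right_cross φ _ _
  change ⟪L v, ‖gaussNormal φ o f p‖⁻¹ • gaussNormal φ o f p⟫ = 0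
  rw [inner_smul_right, ← e.sum_repr' v, Fin.sum_univ_two, map_add, map_smul, map_smul,
    inner_add_left, real_inner_smul_left, real_inner_smul_left, h0, h1]
  simp

lemma mfderiv_gaussLift_mem_contactSpace {φ : ∀ x : X, TangentSpace (𝓡 7) x [⋀^Fin 3]→L[ℝ] ℝ}
    (hφ : IsG2Manifold φ) {o : ∀ p : S, Orientation ℝ (TangentSpace (𝓡 2) p) (Fin 2)}
    {f : S → X} (hf : IsImmersedSurface f) {p : S}
    (h : MDifferentiableAt (𝓡 2) (𝓡 7).tangent (gaussLift φ o f) p)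
    (v : TangentSpace (𝓡 2) p) :
    mfderiv (𝓡 2) (𝓡 7).tangent (gaussLift φ o f) p v ∈ contactSpace (gaussLift φ o f p) := by
  constructor
  -- `⟨ζ, ζ⟩` is constant along the lift, so the derivative is tangent to the unit sphere bundle.
  · have h1 := mvfderiv_comp_apply_of_eq (I' := 𝓡 2) (I := (𝓡 7).tangent)
      (g := fun ζ : TangentBundle (𝓡 7) X => ⟪ζ.2, ζ.2⟫) (y := gaussLift φ o f p) (x := p)
      (mdiff_inner_self _) h rfl v
    have hconst : (fun ζ : TangentBundle (𝓡 7) X => ⟪ζ.2, ζ.2⟫) ∘ gaussLift φ o f =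
        fun _ => (1 : ℝ) := by
      funext q
      have hq : ‖(gaussLift φ o f q).2‖ = 1 := gaussLift_mem_unitTangentBundle hφ o hf q
      simp [hq]
    rw [hconst, mvfderiv_const] at h1
    exact h1.symm
  · have h1 : projDeriv (gaussLift φ o f p)
        (mfderiv (𝓡 2) (𝓡 7).tangent (gaussLift φ o f) p v) ∈ perp (gaussLift φ o f p) := by
      rw [projDeriv_mfderiv_gaussLift h]
      exact mfderiv_mem_perp_gaussLift φ o f p v
    exact h1

/-! ### Conformality -/

lemma surfaceJ_finOrthonormalBasis
    (o : ∀ p : S, Orientation ℝ (TangentSpace (𝓡 2) p) (Fin 2)) (p : S) :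
    surfaceJ o p ((o p).finOrthonormalBasis two_pos (finrank_tangentSpace p).out 0) =
      (o p).finOrthonormalBasis two_pos (finrank_tangentSpace p).out 1 ∧
    surfaceJ o p ((o p).finOrthonormalBasis two_pos (finrank_tangentSpace p).out 1) =
      -(o p).finOrthonormalBasis two_pos (finrank_tangentSpace p).out 0 := by
  set e := (o p).finOrthonormalBasis two_pos (finrank_tangentSpace p).out with he
  have h01 : (o p).areaForm (e 0) (e 1) = 1 := by
    rw [Orientation.areaForm_to_volumeForm, (o p).volumeForm_robust e
      ((o p).finOrthonormalBasis_orientation _ _), Basis.det_apply]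
    rw [← Matrix.det_one (n := Fin 2), ← e.toBasis.toMatrix_self]
    congr 2
    ext1 i
    fin_cases i <;> simp
  have h0 : (o p).rightAngleRotation (e 0) = e 1 := by
    have := e.sum_repr' ((o p).rightAngleRotation (e 0))
    rw [← this, Fin.sum_univ_two, Orientation.inner_rightAngleRotation_right,
      Orientation.inner_rightAngleRotation_right, Orientation.areaForm_apply_self,
      Orientation.areaForm_swap, h01]
    simp
  refine ⟨h0, ?_⟩
  change (o p).rightAngleRotation (e 1) = _
  rw [← h0, Orientation.rightAngleRotation_rightAngleRotation]

lemma _root_.OrthonormalBasis.exists_inner_map_eq_mul_iff {E F : Type*} [NormedAddCommGroup E]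
    [InnerProductSpace ℝ E] [NormedAddCommGroup F] [InnerProductSpace ℝ F]
    (e : OrthonormalBasis (Fin 2) ℝ E) (L : E →ₗ[ℝ] F) :
    (∃ ρ : ℝ, 0 < ρ ∧ ∀ v w : E, ⟪L v, L w⟫ = ρ * ⟪v, w⟫) ↔
      ∃ ρ : ℝ, 0 < ρ ∧ ‖L (e 0)‖ ^ 2 = ρ ∧ ‖L (e 1)‖ ^ 2 = ρ ∧ ⟪L (e 0), L (e 1)⟫ = 0 := by
  refine exists_congr fun ρ => and_congr_right fun _ => ⟨fun h => ?_, fun ⟨h0, h1, h01⟩ v w => ?_⟩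
  · rw [← real_inner_self_eq_norm_sq, ← real_inner_self_eq_norm_sq, h, h, h]
    simp [e.inner_eq_ite]
  · have h10 : ⟪L (e 1), L (e 0)⟫ = 0 := by rw [real_inner_comm, h01]
    rw [← e.sum_inner_mul_inner v w]
    conv_lhs => rw [← e.sum_repr' v, ← e.sum_repr' w]
    simp only [Fin.sum_univ_two, map_add, map_smul, inner_add_left, inner_add_right,
      real_inner_smul_left, real_inner_smul_right, real_inner_self_eq_norm_sq, h0, h1, h01, h10]
    rw [real_inner_comm v, real_inner_comm v]
    ring

/-- At each point the condition `f_* (J v) = η × f_* v`, where `η` is the Gauss lift, says that `f`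
is conformal at this point. -/
lemma mfderiv_surfaceJ_iff {φ : ∀ x : X, TangentSpace (𝓡 7) x [⋀^Fin 3]→L[ℝ] ℝ}
    (hφ : IsG2Manifold φ) (o : ∀ p : S, Orientation ℝ (TangentSpace (𝓡 2) p) (Fin 2))
    {f : S → X} (hf : IsImmersedSurface f) (p : S) :
    (∀ v, mfderiv (𝓡 2) (𝓡 7) f p (surfaceJ o p v) =
      cross φ (gaussLift φ o f p).2 (mfderiv (𝓡 2) (𝓡 7) f p v)) ↔
    ∃ ρ : ℝ, 0 < ρ ∧ ∀ v w : TangentSpace (𝓡 2) p,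
      ⟪(mfderiv (𝓡 2) (𝓡 7) f p v : TangentSpace (𝓡 7) (f p)),
        (mfderiv (𝓡 2) (𝓡 7) f p w : TangentSpace (𝓡 7) (f p))⟫ = ρ * ⟪v, w⟫ := by
  obtain ⟨hJ0, hJ1⟩ := surfaceJ_finOrthonormalBasis o p
  set e := (o p).finOrthonormalBasis two_pos (finrank_tangentSpace p).out with he
  let L : TangentSpace (𝓡 2) p →ₗ[ℝ] TangentSpace (𝓡 7) (f p) :=
    (mfderiv (𝓡 2) (𝓡 7) f p).toLinearMap
  let N : TangentSpace (𝓡 7) (f p) := cross φ (L (e 0)) (L (e 1))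
  refine Iff.trans ?_ ((unit_cross_eq_iff hφ
    (linearIndependent_mfderiv hf e.orthonormal.linearIndependent)).trans
      (e.exists_inner_map_eq_mul_iff L).symm)
  change (∀ v, (L ∘ₗ surfaceJ o p) v = (crossLeft φ (‖N‖⁻¹ • N) ∘ₗ L) v) ↔
    L (e 1) = crossLeft φ (‖N‖⁻¹ • N) (L (e 0)) ∧ -L (e 0) = crossLeft φ (‖N‖⁻¹ • N) (L (e 1))
  constructor
  · intro h
    have h0 := h (e 0)
    have h1 := h (e 1)
    simp only [LinearMap.comp_apply, hJ0, hJ1, map_neg] at h0 h1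
    exact ⟨h0, h1⟩
  · rintro ⟨h0, h1⟩ v
    refine LinearMap.congr_fun (e.toBasis.ext fun i => ?_) v
    fin_cases i
    · simpa [hJ0] using h0
    · simpa [hJ1] using h1

end GaussLift

end G2Geom

theorem mainTheorem4 {X : Type*} [TopologicalSpace X] [ChartedSpace (EuclideanSpace ℝ (Fin 7)) X]
    [IsManifold (𝓡 7) ∞ X]
    [RiemannianBundle (fun x : X => TangentSpace (𝓡 7) x)]
    [IsContMDiffRiemannianBundle (𝓡 7) ∞ (EuclideanSpace ℝ (Fin 7))
      (fun x : X => TangentSpace (𝓡 7) x)]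
    (φ : ∀ x : X, TangentSpace (𝓡 7) x [⋀^Fin 3]→L[ℝ] ℝ) (hφ : IsG2Manifold φ)
    {S : Type*} [TopologicalSpace S] [ChartedSpace (EuclideanSpace ℝ (Fin 2)) S]
    [IsManifold (𝓡 2) ∞ S]
    [RiemannianBundle (fun p : S => TangentSpace (𝓡 2) p)]
    [IsContMDiffRiemannianBundle (𝓡 2) ∞ (EuclideanSpace ℝ (Fin 2))
      (fun p : S => TangentSpace (𝓡 2) p)]
    (o : ∀ p : S, Orientation ℝ (TangentSpace (𝓡 2) p) (Fin 2)) (ho : IsSurfaceOrientation o)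
    (f : S → X) (hf : IsImmersedSurface f) :
    (∀ p, gaussLift φ o f p ∈ unitTangentBundle X) ∧
    ContMDiff (𝓡 2) (𝓡 7).tangent ∞ (gaussLift φ o f) ∧
    ∃ D : ∀ p : S, TangentSpace (𝓡 2) p →ₗ[ℝ] contactSpace (gaussLift φ o f p),
      (∀ (p : S) (v : TangentSpace (𝓡 2) p),
        (D p v : TangentSpace (𝓡 7).tangent (gaussLift φ o f p)) =
          mfderiv (𝓡 2) (𝓡 7).tangent (gaussLift φ o f) p v) ∧
      ((∀ (p : S) (v : TangentSpace (𝓡 2) p),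
          horizontalComponent (gaussLift φ o f p) (D p (surfaceJ o p v)) =
            horizontalJ φ (gaussLift φ o f p)
              (horizontalComponent (gaussLift φ o f p) (D p v))) ↔
        IsConformal f) := by
  have hsm := contMDiff_gaussLift hφ ho hf
  have hd (p : S) : MDifferentiableAt (𝓡 2) (𝓡 7).tangent (gaussLift φ o f) p :=
    (hsm p).mdifferentiableAt (by simp)
  refine ⟨gaussLift_mem_unitTangentBundle hφ o hf, hsm, fun p =>
    (mfderiv (𝓡 2) (𝓡 7).tangent (gaussLift φ o f) p).toLinearMap.codRestrict _
      (mfderiv_gaussLift_mem_contactSpace hφ hf (hd p)), fun _ _ => rfl, ?_⟩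
  have key (p : S) := mfderiv_surfaceJ_iff hφ o hf p
  simp only [horizontalComponent_eq_horizontalJ_iff]
  refine Iff.trans (forall_congr' fun p => Iff.trans (forall_congr' fun v => ?_) (key p)) ?_
  · exact Iff.of_eq (congrArg₂ (fun a b : TangentSpace (𝓡 7) (f p) =>
      a = cross φ (gaussLift φ o f p).2 b) (projDeriv_mfderiv_gaussLift (hd p) _)
      (projDeriv_mfderiv_gaussLift (hd p) _))
  · refine ⟨fun h => ?_, fun ⟨ρ, hρ, h⟩ p => ⟨ρ p, hρ p, h p⟩⟩
    choose ρ hρ h using h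
    exact ⟨ρ, hρ, h⟩
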